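/- Let $\Omega\subseteq\mathbb R^d$ be open and bounded, let $1\le p\le\infty$, and for $\delta>0$ put $\Omega_\delta=\bigcup_{x\in\Omega}\overline{B_\delta(x)}$. Assume that for every $\delta>0$ the set $\Omega_\delta$ is a $W^{1,p}$-extension domain: there is a constant $C$ such that every $u\in W^{1,p}(\Omega_\delta)$ has an extension $\bar u\in W^{1,p}(\mathbb R^d)$, $\bar u=u$ a.e. on $\Omega_\delta$, with $\|\bar u\|_{W^{1,p}(\mathbb R^d)}\le C\|u\|_{W^{1,p}(\Omega_\delta)}$. Let $m\in\mathbb N$, $c_1,\dots,c_m\in\mathbb R$, and for each $\delta>0$ let $\mu_{\delta,1},\dots,\mu_{\delta,m}\in L^1(\mathbb R^d)$ be real-valued with $\operatorname{supp}\mu_{\delta,k}\subseteq\overline{B_\delta(0)}$. Assume that for each $k\le\min(m,d)$, with $\hat e_k$ the $k$-th standard basis vector of $\mathbb R^d$, there are $M<\infty$ and a continuous nondecreasing $\omega:[0,\infty)\to[0,\infty)$ with $\omega(0)=0$ such that, for all $\delta>0$, - (i) $\int_{\mathbb R^d}|\mu_{\delta,k}(z)|\,|z|\,dz<M$; - (ii)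 $\left|\int_{\mathbb R^d}\mu_{\delta,k}(z)\,z\,dz-\hat e_k\right|\le\omega(\delta)$; - (iii') $\int_{\mathbb R^d\setminus B_\delta(0)}|\mu_{\delta,k}(z)|\,|z|\,dz\le\omega(\delta)$. For $u\in L^p(\Omega_\delta)$ let $\overline{\mathcal D_{\delta,k}}u(x)=\int_{\mathbb R^d}[u(x+z)-u(x)]\mu_{\delta,k}(z)\,dz$ for $x\in\Omega$, and $\overline{\mathcal D_{\delta,k}}u(x)=0$ for $x\in\Omega_\delta\setminus\Omega$. Define $$A_\delta u=\sum_{k=1}^m c_k\overline{\mathcal D_{\delta,k}}u,\qquad G_\delta u=\big(c_1\overline{\mathcal D_{\delta,1}}u,\dots,c_m\overline{\mathcal D_{\delta,m}}u\big),\qquad \mathrm{Div}_\delta(u_1,\dots,u_m)=\sum_{k=1}^m c_k\overline{\mathcal D_{\delta,k}}u_k .$$ Then for every $\delta>0$ the integrals defining these operators converge absolutely for a.e. $x\in\Omega$, and $A_\delta:L^p(\Omega_\delta)\to L^p(\Omega_\delta)$, $G_\delta:L^p(\Omega_\delta)\to L^p(\Omega_\delta)^m$ and $\mathrm{Div}_\delta:L^p(\Omega_\delta)^m\to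 L^p(\Omega_\delta)$ are well-defined bounded linear operators. Suppose moreover that $p<\infty$, and let $\delta_0>0$. - If $m\le d$ and $u\in W^{1,p}(\Omega_{\delta_0})$, then $\left\|A_\delta u-\sum_{k=1}^m c_k\partial_k u\right\|_{L^p(\Omega)}\to0$ as $\delta\to0^+$. - If $m=d$, $c_1=\dots=c_d=1$ and $u\in W^{1,p}(\Omega_{\delta_0})$, then $\|G_\delta u-\nabla u\|_{L^p(\Omega)^d}\to0$ as $\delta\to0^+$. - If $m=d$, $c_1=\dots=c_d=1$ and $\vec u\in W^{1,p}(\Omega_{\delta_0})^d$, then $\|\mathrm{Div}_\delta\vec u-\operatorname{div}\vec u\|_{L^p(\Omega)}\to0$ as $\delta\to0^+$. (For $\delta<\delta_0$ the operators are applied to the restrictions to $\Omega_\delta\subseteq\Omega_{\delta_0}$.) -/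

import Mathlib

open MeasureTheory Filter Topology
open scoped NNReal ENNReal

namespace NonlocalCalculus

/-- The ambient space `ℝ^d` with its Euclidean norm. -/
abbrev Space (d : ℕ) : Type := EuclideanSpace ℝ (Fin d)

/-- The `k`-th standard basis vector of `ℝ^d`. -/
noncomputable def stdBasis {d : ℕ} (k : Fin d) : Space d := EuclideanSpace.single k 1

/-! ### Domains -/

/-- The collar `Γ_δ` of width `δ` of `Ω`. -/
def collar {d : ℕ} (Ω : Set (Space d)) (δ : ℝ) : Set (Space d) :=
  (⋃ x ∈ Ω, Metric.closedBall x δ) \ Ω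

/-- The nonlocal domain `Ω_δ = Ω ∪ Γ_δ`. -/
def nonlocalDomain {d : ℕ} (Ω : Set (Space d)) (δ : ℝ) : Set (Space d) :=
  Ω ∪ collar Ω δ

/-- Lebesgue measure on a set `U`; `L^p(U)` is `Lp ℝ p (leb U)`. -/
noncomputable abbrev leb {d : ℕ} (U : Set (Space d)) : Measure (Space d) :=
  volume.restrict U

/-! ### Sobolev functions -/

/-- `g` is a weak (distributional) gradient of `u` on the open set `U`: for every test function
`φ ∈ C_c^∞(U)` and every `k`, `∫_U u ∂_k φ = - ∫_U g_k φ`. -/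
def IsWeakGradient {d : ℕ} (U : Set (Space d)) (u : Space d → ℝ) (g : Space d → Space d) : Prop :=
  ∀ φ : Space d → ℝ, ContDiff ℝ (⊤ : ℕ∞) φ → HasCompactSupport φ → tsupport φ ⊆ U →
    ∀ k : Fin d,
      ∫ x in U, u x * fderiv ℝ φ x (stdBasis k) = - ∫ x in U, g x k * φ x

/-- `u ∈ W^{1,p}(U)` with weak gradient `∇u = g`. -/
structure MemW1p {d : ℕ} (U : Set (Space d)) (p : ℝ≥0∞) (u : Space d → ℝ)
    (g : Space d → Space d) : Prop where
  memLp : MemLp u p (leb U)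
  memLp_grad : MemLp g p (leb U)
  weakGradient : IsWeakGradient U u g

/-- The norm `‖u‖_{L^p(U)} + ‖∇u‖_{L^p(U)}` of `W^{1,p}(U)`. -/
noncomputable def w1pNorm {d : ℕ} (U : Set (Space d)) (p : ℝ≥0∞) (u : Space d → ℝ)
    (g : Space d → Space d) : ℝ≥0∞ :=
  eLpNorm u p (leb U) + eLpNorm g p (leb U)

/-- `U` is an extension domain (for `W^{1,p}`): every `u ∈ W^{1,p}(U)` has an extension
`ū ∈ W^{1,p}(ℝ^d)` with `‖ū‖_{W^{1,p}(ℝ^d)} ≤ C ‖u‖_{W^{1,p}(U)}`, where `C` does not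
depend on `u`. -/
def IsExtensionDomain {d : ℕ} (p : ℝ≥0∞) (U : Set (Space d)) : Prop :=
  ∃ C : ℝ≥0, ∀ (u : Space d → ℝ) (g : Space d → Space d), MemW1p U p u g →
    ∃ (u' : Space d → ℝ) (g' : Space d → Space d),
      MemW1p Set.univ p u' g' ∧ u' =ᵐ[leb U] u ∧
        w1pNorm Set.univ p u' g' ≤ C * w1pNorm U p u g

/-! ### Kernels -/

/-- The hypotheses on a family of kernels `{μ_δ}_{δ > 0}` in the direction `a`:
there is a continuous nondecreasing `ω : [0,∞) → [0,∞)` with `ω(0) = 0` such that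
(i) the first absolute moments are bounded, (ii) the first moments converge to `a` with modulus `ω`,
(iii') the first moments concentrate at the origin with modulus `ω`. -/
structure MomentHypotheses {d : ℕ} (μ : ℝ → Space d → ℝ) (a : Space d) : Prop where
  boundedMoments : ∃ M : ℝ, ∀ δ > 0,
    Integrable (fun z => |μ δ z| * ‖z‖) ∧ ∫ z, |μ δ z| * ‖z‖ < M
  modulus : ∃ ω : ℝ → ℝ, ContinuousOn ω (Set.Ici 0) ∧ MonotoneOn ω (Set.Ici 0) ∧
    (∀ t ≥ 0, 0 ≤ ω t) ∧ ω 0 = 0 ∧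
    (∀ δ > 0, ‖(∫ z, μ δ z • z) - a‖ ≤ ω δ) ∧
    (∀ δ > 0, ∫ z in (Metric.ball 0 δ)ᶜ, |μ δ z| * ‖z‖ ≤ ω δ)

/-! ### Nonlocal operators -/

/-- The integrand `z ↦ [u(x+z) - u(x)] κ(z)` of the nonlocal derivative at `x`. -/
def integrand {d : ℕ} (κ : Space d → ℝ) (u : Space d → ℝ) (x z : Space d) : ℝ :=
  (u (x + z) - u x) * κ z

/-- The nonlocal directional derivative `u ↦ ∫ [u(x+z) - u(x)] κ(z) dz` with kernel `κ`. -/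
noncomputable def nonlocalDeriv {d : ℕ} (κ : Space d → ℝ) (u : Space d → ℝ) (x : Space d) : ℝ :=
  ∫ z, integrand κ u x z

/-- The extended nonlocal derivative: the nonlocal derivative on `Ω`, and zero on the collar. -/
noncomputable def extNonlocalDeriv {d : ℕ} (Ω : Set (Space d)) (κ : Space d → ℝ)
    (u : Space d → ℝ) : Space d → ℝ :=
  Ω.indicator (nonlocalDeriv κ u)

/-- The linear nonlocal differential operator `𝒜 u = ∑_k c_k D_k u`. -/
noncomputable def nonlocalOp {d m : ℕ} (Ω : Set (Space d)) (c : Fin m → ℝ)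
    (κ : Fin m → Space d → ℝ) (u : Space d → ℝ) (x : Space d) : ℝ :=
  ∑ k, c k * extNonlocalDeriv Ω (κ k) u x

/-- The operator `𝒢 u = (c_1 D_1 u, …, c_m D_m u)`; it is the nonlocal gradient when
`m = d` and all `c_k = 1`. -/
noncomputable def nonlocalGrad {d m : ℕ} (Ω : Set (Space d)) (c : Fin m → ℝ)
    (κ : Fin m → Space d → ℝ) (u : Space d → ℝ) (x : Space d) (k : Fin m) : ℝ :=
  c k * extNonlocalDeriv Ω (κ k) u x

/-- The operator `𝒟 (u_1, …, u_m) = ∑_k c_k D_k u_k`; it is the nonlocal divergence when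
`m = d` and all `c_k = 1`. -/
noncomputable def nonlocalDiv {d m : ℕ} (Ω : Set (Space d)) (c : Fin m → ℝ)
    (κ : Fin m → Space d → ℝ) (v : Fin m → Space d → ℝ) (x : Space d) : ℝ :=
  ∑ k, c k * extNonlocalDeriv Ω (κ k) (v k) x

end NonlocalCalculus

open NonlocalCalculus

/-!
The operators are bounded because `D u(x) = ∫ [u(x + z) - u(x)] κ(z) dz` averages differences of
translates of `u` against the integrable weight `|κ|`. The integral Minkowski inequality, in the
form `eLpNorm_lintegral_mul_le` (an average of functions of `L^p` norm at most `K` against a weight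
of mass `A` has norm at most `A K`), gives `‖D u‖_p ≤ 2 ‖κ‖₁ ‖u‖_p`, and in particular the absolute
convergence of the integrals almost everywhere. The kernel lives in the closed ball of radius `δ`,
so on `Ω` only the values of `u` on `Ω_δ` enter, and `u` may be replaced by a measurable function
that vanishes outside `Ω_δ`.

For the convergence, split
`D_δ u(x) - ∇u(x) · a = ∫ [u(x + z) - u(x) - ∇u(x) · z] κ_δ(z) dz + ∇u(x) · (∫ κ_δ(z) z dz - a)`.
The `L^p` norm of the second term is at most `ω(δ) ‖∇u‖_p`. For the first, a Sobolev function
satisfies `u(x + z) - u(x) = ∫₀¹ ∇u(x + tz) · z dt` for almost every `x`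
(`IsWeakGradient.ae_sub_eq_integral`); this follows directly from the definition of the weak
gradient, by testing against a smooth function and moving the translation onto it, so that no
approximation by smooth functions is needed. Since for `x ∈ Ω` and `|z| ≤ δ < δ₀` the whole segment
from `x` to `x + z` lies in `Ω_{δ₀}`, the identity can be used on `Ω` itself. Hence the Taylor
remainder has `L^p(Ω)` norm at most `|z|` times the modulus of continuity of `∇u` in `L^p`
(`translationModulus`), and the first term is at most `∫ |κ_δ(z)| |z| dz` times that modulus, which
tends to zero because translations are continuous in `L^p` for `p < ∞`.
-/

namespace NonlocalCalculus

/-! ### Averages of `L^p` functions -/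

/-- The integral Minkowski inequality for a family of uniformly bounded `L^p` norm. For `p < ∞` it is
Hölder's inequality in `z` followed by Tonelli's theorem. -/
theorem eLpNorm_lintegral_le {α β : Type*} [MeasurableSpace α] [MeasurableSpace β]
    {μ : Measure α} [SFinite μ] {ν : Measure β} [IsFiniteMeasure ν] {p : ℝ≥0∞} (hp : 1 ≤ p)
    {F : α → β → ℝ≥0∞} (hF : Measurable (Function.uncurry F)) {K : ℝ≥0∞}
    (hK : ∀ᵐ z ∂ν, eLpNorm (fun x => F x z) p μ ≤ K) :
    eLpNorm (fun x => ∫⁻ z, F x z ∂ν) p μ ≤ ν Set.univ * K := by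
  have hp0 : p ≠ 0 := (zero_lt_one.trans_le hp).ne'
  rcases eq_or_ne p ∞ with rfl | hpt
  · have h1 : ∀ᵐ z ∂ν, ∀ᵐ x ∂μ, F x z ≤ K := by
      filter_upwards [hK] with z hz
      rw [eLpNorm_exponent_top] at hz
      filter_upwards [ae_le_eLpNormEssSup (f := fun x => F x z) (μ := μ)] with x hx
      exact (hx : F x z ≤ _).trans hz
    have h2 : ∀ᵐ x ∂μ, ∀ᵐ z ∂ν, F x z ≤ K :=
      Measure.ae_ae_comm (μ := ν) (ν := μ) (p := fun z x => F x z ≤ K)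
        (measurableSet_le (hF.comp measurable_swap) measurable_const) |>.1 h1
    rw [eLpNorm_exponent_top]
    refine eLpNormEssSup_le_of_ae_enorm_bound ?_
    filter_upwards [h2] with x hx
    calc ‖∫⁻ z, F x z ∂ν‖ₑ = ∫⁻ z, F x z ∂ν := rfl
      _ ≤ ∫⁻ _, K ∂ν := lintegral_mono_ae hx
      _ = ν Set.univ * K := by rw [lintegral_const, mul_comm]
  · have hr : 1 ≤ p.toReal := by
      rw [← ENNReal.toReal_one]; exact ENNReal.toReal_mono hpt hp
    have hr0 : 0 < p.toReal := by linarith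
    rw [eLpNorm_eq_lintegral_rpow_enorm_toReal hp0 hpt, one_div, ENNReal.rpow_inv_le_iff hr0]
    have hK' : ∀ᵐ z ∂ν, ∫⁻ x, F x z ^ p.toReal ∂μ ≤ K ^ p.toReal := by
      filter_upwards [hK] with z hz
      rwa [eLpNorm_eq_lintegral_rpow_enorm_toReal hp0 hpt, one_div,
        ENNReal.rpow_inv_le_iff hr0] at hz
    -- Hölder's inequality against the constant function `1`, for each fixed `x`.
    have hJ : ∀ x, (∫⁻ z, F x z ∂ν) ^ p.toReal
        ≤ ν Set.univ ^ (p.toReal - 1) * ∫⁻ z, F x z ^ p.toReal ∂ν := by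
      intro x
      have hm : Measurable (F x) := hF.comp measurable_prodMk_left
      have h := eLpNorm_le_eLpNorm_mul_rpow_measure_univ (μ := ν) hp
        (f := F x) hm.aestronglyMeasurable
      rw [eLpNorm_one_eq_lintegral_enorm, eLpNorm_eq_lintegral_rpow_enorm_toReal hp0 hpt] at h
      have h' := ENNReal.rpow_le_rpow h hr0.le
      rw [ENNReal.mul_rpow_of_nonneg _ _ hr0.le, ← ENNReal.rpow_mul, ← ENNReal.rpow_mul,
        one_div, inv_mul_cancel₀ hr0.ne', ENNReal.rpow_one, mul_comm] at h'
      refine h'.trans_eq ?_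
      congr 2
      simp only [ENNReal.toReal_one]
      field_simp
    calc ∫⁻ x, ‖∫⁻ z, F x z ∂ν‖ₑ ^ p.toReal ∂μ
        ≤ ∫⁻ x, ν Set.univ ^ (p.toReal - 1) * ∫⁻ z, F x z ^ p.toReal ∂ν ∂μ :=
          lintegral_mono fun x => hJ x
      _ = ν Set.univ ^ (p.toReal - 1) * ∫⁻ x, ∫⁻ z, F x z ^ p.toReal ∂ν ∂μ := by
          refine lintegral_const_mul _ ?_
          exact (hF.pow_const _).lintegral_prod_right'
      _ = ν Set.univ ^ (p.toReal - 1) * ∫⁻ z, ∫⁻ x, F x z ^ p.toReal ∂μ ∂ν := by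
          rw [lintegral_lintegral_swap]
          exact (hF.pow_const _).aemeasurable
      _ ≤ ν Set.univ ^ (p.toReal - 1) * (ν Set.univ * K ^ p.toReal) := by
          gcongr
          refine (lintegral_mono_ae hK').trans_eq ?_
          rw [lintegral_const, mul_comm]
      _ = (ν Set.univ * K) ^ p.toReal := by
          rw [ENNReal.mul_rpow_of_nonneg _ _ hr0.le, ← mul_assoc]
          congr 1
          nth_rewrite 2 [← ENNReal.rpow_one (ν Set.univ)]
          rw [← ENNReal.rpow_add_of_nonneg _ _ (by linarith) zero_le_one, sub_add_cancel]

/-- The integral Minkowski inequality with a weight `w`: only those `z` at which the weight does not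
vanish matter. -/
theorem eLpNorm_lintegral_mul_le {α β : Type*} [MeasurableSpace α] [MeasurableSpace β]
    {μ : Measure α} [SFinite μ] {ν : Measure β} {p : ℝ≥0∞} (hp : 1 ≤ p)
    {F : α → β → ℝ≥0∞} (hF : Measurable (Function.uncurry F)) {w : β → ℝ≥0∞}
    (hw : AEMeasurable w ν) (hwfin : ∫⁻ z, w z ∂ν ≠ ∞) {K : ℝ≥0∞}
    (hK : ∀ᵐ z ∂ν, w z ≠ 0 → eLpNorm (fun x => F x z) p μ ≤ K) :
    eLpNorm (fun x => ∫⁻ z, F x z * w z ∂ν) p μ ≤ (∫⁻ z, w z ∂ν) * K := by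
  have : IsFiniteMeasure (ν.withDensity w) := isFiniteMeasure_withDensity hwfin
  have h := eLpNorm_lintegral_le (μ := μ) (ν := ν.withDensity w) hp hF (K := K)
    ((ae_withDensity_iff' hw).2 hK)
  rw [withDensity_apply _ MeasurableSet.univ, Measure.restrict_univ] at h
  refine le_trans (le_of_eq ?_) h
  congr 1
  ext x
  have hm : Measurable (F x) := hF.comp measurable_prodMk_left
  rw [lintegral_withDensity_eq_lintegral_mul₀ hw hm.aemeasurable]
  simp only [Pi.mul_apply, mul_comm]

theorem ae_lt_top_of_eLpNorm_ne_top {α : Type*} [MeasurableSpace α] {μ : Measure α} {p : ℝ≥0∞}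
    (hp : p ≠ 0) {f : α → ℝ≥0∞} (hf : AEMeasurable f μ) (h : eLpNorm f p μ ≠ ∞) :
    ∀ᵐ x ∂μ, f x < ∞ := by
  rcases eq_or_ne p ∞ with rfl | hpt
  · rw [eLpNorm_exponent_top] at h
    filter_upwards [ae_le_eLpNormEssSup (f := f) (μ := μ)] with x hx
    exact lt_of_le_of_lt hx h.lt_top
  · have h1 := lintegral_rpow_enorm_lt_top_of_eLpNorm_lt_top hp hpt h.lt_top
    filter_upwards [ae_lt_top' (hf.pow_const _) h1.ne] with x hx
    exact (ENNReal.rpow_lt_top_iff_of_pos (ENNReal.toReal_pos hp hpt)).1 hx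

theorem enorm_inner_le_enorm {F : Type*} [NormedAddCommGroup F] [InnerProductSpace ℝ F]
    (x y : F) : ‖(inner ℝ x y : ℝ)‖ₑ ≤ ‖x‖ₑ * ‖y‖ₑ := by
  rw [← ofReal_norm, ← ofReal_norm, ← ofReal_norm, ← ENNReal.ofReal_mul (norm_nonneg x)]
  exact ENNReal.ofReal_le_ofReal (norm_inner_le_norm x y)

theorem coeFn_sum_smul_ae_eq {α ι : Type*} [MeasurableSpace α] {ν : Measure α} {p : ℝ≥0∞}
    [Fintype ι] {c : ι → ℝ} {F : ι → Lp ℝ p ν} {f : ι → α → ℝ} (h : ∀ k, F k =ᵐ[ν] f k) :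
    ⇑(∑ k, c k • F k) =ᵐ[ν] fun x => ∑ k, c k * f k x := by
  have h1 : ∀ᵐ x ∂ν, ∀ k, (c k • F k) x = c k * f k x := ae_all_iff.2 fun k => by
    filter_upwards [Lp.coeFn_smul (c k) (F k), h k] with x h1 h2
    rw [h1, Pi.smul_apply, h2, smul_eq_mul]
  filter_upwards [Lp.coeFn_finsetSum Finset.univ fun k => c k • F k, h1] with x hx h1
  rw [hx, Finset.sum_apply]
  exact Finset.sum_congr rfl fun k _ => h1 k

theorem tendsto_eLpNorm_const_smul_zero {α τ E : Type*} [MeasurableSpace α] {ν : Measure α}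
    [NormedAddCommGroup E] [NormedSpace ℝ E] {p : ℝ≥0∞} {l : Filter τ} {f : τ → α → E} (c : ℝ)
    (h : Tendsto (fun t => eLpNorm (f t) p ν) l (𝓝 0)) :
    Tendsto (fun t => eLpNorm (c • f t) p ν) l (𝓝 0) := by
  simp_rw [eLpNorm_const_smul]
  simpa using ENNReal.Tendsto.const_mul h (Or.inr (enorm_ne_top (x := c)))

theorem tendsto_eLpNorm_smul_stdBasis_zero {d : ℕ} {α τ : Type*} [MeasurableSpace α]
    {ν : Measure α} {p : ℝ≥0∞} {l : Filter τ} {f : τ → α → ℝ} (k : Fin d)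
    (h : Tendsto (fun t => eLpNorm (f t) p ν) l (𝓝 0)) :
    Tendsto (fun t => eLpNorm (fun x => f t x • (stdBasis k : Space d)) p ν) l (𝓝 0) := by
  refine h.congr fun t => eLpNorm_congr_norm_ae (ae_of_all _ fun x => ?_)
  simp [norm_smul, stdBasis]

theorem tendsto_eLpNorm_sum_zero {α ι τ E : Type*} [MeasurableSpace α] {μ : Measure α}
    [NormedAddCommGroup E] {p : ℝ≥0∞} (hp : 1 ≤ p) {s : Finset ι} {l : Filter τ}
    {f : ι → τ → α → E} (hm : ∀ i ∈ s, ∀ᶠ t in l, AEStronglyMeasurable (f i t) μ)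
    (h : ∀ i ∈ s, Tendsto (fun t => eLpNorm (f i t) p μ) l (𝓝 0)) :
    Tendsto (fun t => eLpNorm (fun x => ∑ i ∈ s, f i t x) p μ) l (𝓝 0) := by
  have h1 := tendsto_finsetSum s h
  rw [Finset.sum_const_zero] at h1
  refine tendsto_of_tendsto_of_tendsto_of_le_of_le' tendsto_const_nhds h1
    (Eventually.of_forall fun _ => zero_le) ?_
  filter_upwards [(eventually_all_finset s).2 hm] with t ht
  have := eLpNorm_sum_le ht hp
  rwa [Finset.sum_fn] at this

variable {d : ℕ}

/-! ### The nonlocal domain -/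

theorem mem_nonlocalDomain {Ω : Set (Space d)} {δ : ℝ} (hδ : 0 ≤ δ) {y : Space d} :
    y ∈ nonlocalDomain Ω δ ↔ ∃ x ∈ Ω, y ∈ Metric.closedBall x δ := by
  simp only [nonlocalDomain, collar, Set.union_sdiff_self, Set.mem_union, Set.mem_iUnion,
    exists_prop, or_iff_right_iff_imp]
  exact fun h => ⟨y, h, Metric.mem_closedBall_self hδ⟩

theorem subset_nonlocalDomain (Ω : Set (Space d)) (δ : ℝ) : Ω ⊆ nonlocalDomain Ω δ :=
  Set.subset_union_left

theorem add_mem_nonlocalDomain {Ω : Set (Space d)} {δ : ℝ} {x z : Space d} (hx : x ∈ Ω)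
    (hz : ‖z‖ ≤ δ) : x + z ∈ nonlocalDomain Ω δ :=
  (mem_nonlocalDomain ((norm_nonneg z).trans hz)).2 ⟨x, hx, by simpa using hz⟩

theorem nonlocalDomain_mono (Ω : Set (Space d)) {δ ε : ℝ} (hδ : 0 ≤ δ) (h : δ ≤ ε) :
    nonlocalDomain Ω δ ⊆ nonlocalDomain Ω ε := fun y hy => by
  obtain ⟨x, hx, hxy⟩ := (mem_nonlocalDomain hδ).1 hy
  exact (mem_nonlocalDomain (hδ.trans h)).2 ⟨x, hx, Metric.closedBall_subset_closedBall h hxy⟩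

theorem isOpen_nonlocalDomain {Ω : Set (Space d)} (hΩ : IsOpen Ω) {δ : ℝ} (hδ : 0 ≤ δ) :
    IsOpen (nonlocalDomain Ω δ) := by
  have : nonlocalDomain Ω δ = ⋃ z ∈ Metric.closedBall (0 : Space d) δ, (fun y => y - z) ⁻¹' Ω := by
    ext y
    simp only [mem_nonlocalDomain hδ, Set.mem_iUnion, Set.mem_preimage, exists_prop,
      mem_closedBall_zero_iff]
    constructor
    · rintro ⟨x, hx, hy⟩
      exact ⟨y - x, by rwa [← dist_eq_norm], by simpa using hx⟩
    · rintro ⟨z, hz, hy⟩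
      exact ⟨y - z, hy, by simpa [Metric.mem_closedBall, dist_eq_norm] using hz⟩
  rw [this]
  exact isOpen_biUnion fun z _ => hΩ.preimage (by fun_prop)

theorem isBounded_nonlocalDomain {Ω : Set (Space d)} (hΩ : Bornology.IsBounded Ω) {δ : ℝ}
    (hδ : 0 ≤ δ) : Bornology.IsBounded (nonlocalDomain Ω δ) := by
  obtain ⟨R, hR⟩ := hΩ.subset_closedBall 0
  refine (Metric.isBounded_closedBall (x := (0 : Space d)) (r := R + δ)).subset fun y hy => ?_
  obtain ⟨x, hx, hxy⟩ := (mem_nonlocalDomain hδ).1 hy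
  have := hR hx
  rw [Metric.mem_closedBall] at *
  linarith [dist_triangle y x 0]

/-! ### Sobolev functions along segments -/

/-- A function in `L^p(U)` has an everywhere defined measurable representative that vanishes
outside `U`. -/
theorem _root_.MeasureTheory.MemLp.exists_stronglyMeasurable_extension {E : Type*}
    [NormedAddCommGroup E] {p : ℝ≥0∞}
    {U : Set (Space d)} (hU : MeasurableSet U) {u : Space d → E} (hu : MemLp u p (leb U)) :
    ∃ v : Space d → E, StronglyMeasurable v ∧ v =ᵐ[leb U] u ∧ MemLp v p volume ∧
      eLpNorm v p volume = eLpNorm u p (leb U) ∧ ∀ x ∉ U, v x = 0 := by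
  have hv : U.indicator (hu.1.mk u) =ᵐ[leb U] u := by
    filter_upwards [hu.1.ae_eq_mk, ae_restrict_mem hU] with x hx hxU
    rw [Set.indicator_of_mem hxU, hx]
  refine ⟨U.indicator (hu.1.mk u), hu.1.stronglyMeasurable_mk.indicator hU, hv, ?_, ?_,
    fun x hx => Set.indicator_of_notMem hx _⟩
  · rw [memLp_indicator_iff_restrict hU]
    exact hu.ae_eq hu.1.ae_eq_mk
  · rw [eLpNorm_indicator_eq_eLpNorm_restrict hU]
    exact eLpNorm_congr_ae hu.1.ae_eq_mk.symm

theorem IsWeakGradient.congr {U : Set (Space d)} {u v : Space d → ℝ} {g f : Space d → Space d}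
    (hw : IsWeakGradient U u g) (huv : u =ᵐ[leb U] v) (hgf : g =ᵐ[leb U] f) :
    IsWeakGradient U v f := by
  intro φ hφ hc hs k
  have e1 : ∫ x in U, v x * fderiv ℝ φ x (stdBasis k)
      = ∫ x in U, u x * fderiv ℝ φ x (stdBasis k) :=
    integral_congr_ae (by filter_upwards [huv] with x hx; rw [hx])
  have e2 : ∫ x in U, f x k * φ x = ∫ x in U, g x k * φ x :=
    integral_congr_ae (by filter_upwards [hgf] with x hx; rw [hx])
  rw [e1, e2]
  exact hw φ hφ hc hs k

/-- The weak gradient, tested in an arbitrary direction and with integrals over the whole space. -/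
theorem IsWeakGradient.integral_mul_fderiv {U : Set (Space d)} {u : Space d → ℝ}
    {g : Space d → Space d} (hw : IsWeakGradient U u g) (hu : Integrable u) (hg : Integrable g)
    {φ : Space d → ℝ} (hφ : ContDiff ℝ (⊤ : ℕ∞) φ) (hc : HasCompactSupport φ)
    (hs : tsupport φ ⊆ U) (h : Space d) :
    ∫ x, u x * fderiv ℝ φ x h = -∫ x, inner ℝ (g x) h * φ x := by
  have hφ' : ∀ v, Continuous fun x => fderiv ℝ φ x v := fun v =>
    (hφ.continuous_fderiv (by simp)).clm_apply continuous_const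
  have hi : ∀ v, Integrable fun x => u x * fderiv ℝ φ x v := fun v => by
    obtain ⟨C, hC⟩ := (hc.fderiv_apply ℝ v).exists_bound_of_continuous (hφ' v)
    exact hu.mul_bdd (c := C) (hφ' v).aestronglyMeasurable (ae_of_all _ hC)
  obtain ⟨C, hC⟩ := hc.exists_bound_of_continuous hφ.continuous
  have hgk : ∀ k, Integrable fun x => g x k := fun k =>
    (EuclideanSpace.proj (𝕜 := ℝ) k).integrable_comp hg
  have hj : ∀ k, Integrable fun x => g x k * φ x := fun k =>
    (hgk k).mul_bdd (c := C) hφ.continuous.aestronglyMeasurable (ae_of_all _ hC)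
  have key : ∀ k, ∫ x, u x * fderiv ℝ φ x (stdBasis k) = -∫ x, g x k * φ x := fun k => by
    have := hw φ hφ hc hs k
    rwa [setIntegral_eq_integral_of_forall_compl_eq_zero,
      setIntegral_eq_integral_of_forall_compl_eq_zero] at this
    · intro x hx
      rw [image_eq_zero_of_notMem_tsupport fun h => hx (hs h), mul_zero]
    · intro x hx
      have : fderiv ℝ φ x = 0 := image_eq_zero_of_notMem_tsupport
        fun h => hx (hs (tsupport_fderiv_subset ℝ h))
      rw [this]; simp
  have hh : h = ∑ k, h k • (stdBasis k : Space d) := by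
    ext i
    simp [stdBasis, Pi.single_apply]
  have e1 : ∀ x, u x * fderiv ℝ φ x h = ∑ k, h k * (u x * fderiv ℝ φ x (stdBasis k)) := by
    intro x
    conv_lhs => rw [hh]
    rw [map_sum, Finset.mul_sum]
    refine Finset.sum_congr rfl fun k _ => ?_
    rw [map_smul, smul_eq_mul]; ring
  have e2 : ∀ x, inner ℝ (g x) h * φ x = ∑ k, h k * (g x k * φ x) := by
    intro x
    rw [PiLp.inner_apply, Finset.sum_mul]
    refine Finset.sum_congr rfl fun k _ => ?_
    simp; ring
  simp_rw [e1, e2]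
  rw [integral_finsetSum _ fun k _ => (hi (stdBasis k)).const_mul (h k),
    integral_finsetSum _ fun k _ => (hj k).const_mul (h k), ← Finset.sum_neg_distrib]
  refine Finset.sum_congr rfl fun k _ => ?_
  rw [integral_const_mul, integral_const_mul, key, mul_neg]

/-- The shear `(t, x) ↦ (t, x + th)` preserves the product measure. -/
theorem integrable_comp_add_smul_prod {E : Type*} [NormedAddCommGroup E] {f : Space d → E}
    (hf : Integrable f) (T : Measure ℝ) [IsFiniteMeasure T] (h : Space d) :
    Integrable (fun q : ℝ × Space d => f (q.2 + q.1 • h)) (T.prod volume) := by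
  have h1 : Integrable (fun q : ℝ × Space d => f q.2) (T.prod volume) := hf.comp_snd T
  have h2 : MeasurePreserving (fun q : ℝ × Space d => (q.1, q.2 + q.1 • h))
      (T.prod volume) (T.prod volume) :=
    (MeasurePreserving.id T).skew_product (g := fun t x => x + t • h) (by fun_prop)
      (ae_of_all _ fun t => (measurePreserving_add_right volume (t • h)).map_eq)
  exact h2.integrable_comp_of_integrable h1

/-- The fundamental theorem of calculus along `h`, tested against a smooth `φ`: the translation is
moved onto `φ`, where the classical theorem applies, and each translate `φ(· - th)` is an admissible
test function on `U`. -/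
theorem IsWeakGradient.integral_test_mul_sub {U : Set (Space d)} {u : Space d → ℝ}
    {g : Space d → Space d} (hw : IsWeakGradient U u g) (hu : Integrable u) (hg : Integrable g)
    {Ω : Set (Space d)} (h : Space d)
    (hsub : ∀ t ∈ Set.Icc (0 : ℝ) 1, ∀ x ∈ Ω, x + t • h ∈ U)
    {φ : Space d → ℝ} (hφ : ContDiff ℝ (⊤ : ℕ∞) φ) (hc : HasCompactSupport φ)
    (hs : tsupport φ ⊆ Ω) :
    ∫ x, φ x * (u (x + h) - u x)
      = ∫ x, φ x * ∫ t in Set.Ioc (0 : ℝ) 1, inner ℝ (g (x + t • h)) h := by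
  set T : Measure ℝ := volume.restrict (Set.Ioc (0 : ℝ) 1) with hT
  have hcont : Continuous fun x => fderiv ℝ φ x h :=
    (hφ.continuous_fderiv (by simp)).clm_apply continuous_const
  obtain ⟨C, hC⟩ := hc.exists_bound_of_continuous hφ.continuous
  obtain ⟨C', hC'⟩ := (hc.fderiv_apply ℝ h).exists_bound_of_continuous hcont
  have hφh : Continuous fun x => φ (x - h) := hφ.continuous.comp (by fun_prop)
  have i1 : Integrable fun x => φ x * u (x + h) :=
    (hu.comp_add_right h).bdd_mul (c := C) hφ.continuous.aestronglyMeasurable (ae_of_all _ hC)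
  have i2 : Integrable fun x => φ x * u x :=
    hu.bdd_mul (c := C) hφ.continuous.aestronglyMeasurable (ae_of_all _ hC)
  have i3 : Integrable fun x => φ (x - h) * u x :=
    hu.bdd_mul (c := C) hφh.aestronglyMeasurable (ae_of_all _ fun x => hC _)
  -- Translation invariance of the integral moves the increment from `u` to `φ`.
  have s1 : ∫ x, φ x * (u (x + h) - u x) = ∫ x, (φ (x - h) - φ x) * u x := by
    simp_rw [mul_sub, sub_mul]
    rw [integral_sub i1 i2, integral_sub i3 i2,
      ← integral_add_right_eq_self (fun x => φ (x - h) * u x) h]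
    simp
  have s2 : ∀ x, φ (x - h) - φ x = -∫ t, fderiv ℝ φ (x - t • h) h ∂T := by
    intro x
    have hd : ∀ t ∈ Set.uIcc (0 : ℝ) 1,
        HasDerivAt (fun t : ℝ => φ (x - t • h)) (-(fderiv ℝ φ (x - t • h) h)) t := by
      intro t _
      have a1 : HasDerivAt (fun t : ℝ => x - t • h) (-h) t := by
        simpa using ((hasDerivAt_id t).smul_const h).const_sub x
      have a2 := (hφ.differentiable (by simp) (x - t • h)).hasFDerivAt.comp_hasDerivAt t a1
      rw [map_neg] at a2
      exact a2
    have := intervalIntegral.integral_eq_sub_of_hasDerivAt hd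
      (Continuous.intervalIntegrable
        ((hcont.comp (by fun_prop : Continuous fun t : ℝ => x - t • h)).neg) _ _)
    rw [intervalIntegral.integral_of_le zero_le_one, integral_neg] at this
    simpa using this.symm
  have s3 : ∀ t ∈ Set.Ioc (0 : ℝ) 1, ∫ x, u x * fderiv ℝ φ (x - t • h) h
      = -∫ x, φ x * inner ℝ (g (x + t • h)) h := by
    intro t ht
    -- The support of this translate is `tsupport φ + th`, which is contained in `Ω + th ⊆ U`.
    have hsupp : tsupport (fun x => φ (x - t • h)) ⊆ U := by
      intro x hx
      have : x - t • h ∈ tsupport φ :=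
        tsupport_comp_subset_preimage φ (by fun_prop : Continuous fun x => x - t • h) hx
      simpa using hsub t ⟨ht.1.le, ht.2⟩ _ (hs this)
    have hcs : HasCompactSupport fun x => φ (x - t • h) := by
      have := hc.comp_homeomorph (Homeomorph.addRight (-(t • h)))
      simpa [Function.comp_def, sub_eq_add_neg] using this
    have := hw.integral_mul_fderiv hu hg (φ := fun x => φ (x - t • h))
      (hφ.comp (contDiff_id.sub contDiff_const)) hcs hsupp h
    simp only [sub_eq_add_neg, fderiv_comp_add_right] at this
    simp only [sub_eq_add_neg]
    rw [this, ← integral_add_right_eq_self (fun x => inner ℝ (g x) h * φ (x + -(t • h))) (t • h)]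
    simp [mul_comm]
  have hD : Continuous fun q : Space d × ℝ => fderiv ℝ φ (q.1 - q.2 • h) h :=
    hcont.comp (by fun_prop)
  have j1 : Integrable (Function.uncurry fun x t => u x * fderiv ℝ φ (x - t • h) h)
      (volume.prod T) :=
    (hu.comp_fst T).mul_bdd (c := C') hD.aestronglyMeasurable (ae_of_all _ fun q => hC' _)
  have j2 : Integrable (Function.uncurry fun t x => φ x * inner ℝ (g (x + t • h)) h)
      (T.prod volume) := by
    have hin : Integrable fun x => (inner ℝ (g x) h : ℝ) := hg.inner_const h
    exact (integrable_comp_add_smul_prod hin T h).bdd_mul (c := C)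
      (hφ.continuous.comp continuous_snd).aestronglyMeasurable (ae_of_all _ fun q => hC _)
  calc ∫ x, φ x * (u (x + h) - u x) = ∫ x, (φ (x - h) - φ x) * u x := s1
    _ = -∫ x, ∫ t, u x * fderiv ℝ φ (x - t • h) h ∂T := by
        rw [← integral_neg]
        refine integral_congr_ae (ae_of_all _ fun x => ?_)
        simp only [s2, integral_const_mul]
        ring
    _ = -∫ t, (∫ x, u x * fderiv ℝ φ (x - t • h) h) ∂T := by
        rw [integral_integral_swap j1]
    _ = ∫ t, (∫ x, φ x * inner ℝ (g (x + t • h)) h) ∂T := by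
        rw [← integral_neg]
        refine setIntegral_congr_fun measurableSet_Ioc fun t ht => ?_
        simp only [s3 t ht, neg_neg]
    _ = ∫ x, ∫ t, φ x * inner ℝ (g (x + t • h)) h ∂T := integral_integral_swap j2
    _ = ∫ x, φ x * ∫ t, inner ℝ (g (x + t • h)) h ∂T := by
        simp_rw [integral_const_mul]

/-- The fundamental theorem of calculus for a weakly differentiable function, almost everywhere on a
set `Ω` whose translates by `th`, `0 ≤ t ≤ 1`, stay in `U`. -/
theorem IsWeakGradient.ae_sub_eq_integral {U : Set (Space d)} {u : Space d → ℝ}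
    {g : Space d → Space d} (hw : IsWeakGradient U u g) (hu : Integrable u) (hg : Integrable g)
    {Ω : Set (Space d)} (hΩ : IsOpen Ω) (h : Space d)
    (hsub : ∀ t ∈ Set.Icc (0 : ℝ) 1, ∀ x ∈ Ω, x + t • h ∈ U) :
    ∀ᵐ x, x ∈ Ω → u (x + h) - u x = ∫ t in Set.Ioc (0 : ℝ) 1, inner ℝ (g (x + t • h)) h := by
  have hin : Integrable fun x => (inner ℝ (g x) h : ℝ) := hg.inner_const h
  have k1 : Integrable fun x => u (x + h) - u x := (hu.comp_add_right h).sub hu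
  have k2 : Integrable fun x => ∫ t in Set.Ioc (0 : ℝ) 1, (inner ℝ (g (x + t • h)) h : ℝ) :=
    (integrable_comp_add_smul_prod hin (volume.restrict (Set.Ioc (0 : ℝ) 1)) h).integral_prod_right
  have := hΩ.ae_eq_zero_of_integral_contDiff_smul_eq_zero (μ := volume)
    ((k1.sub k2).locallyIntegrable.locallyIntegrableOn Ω) (by
      intro φ hφ hc hs
      obtain ⟨C, hC⟩ := hc.exists_bound_of_continuous hφ.continuous
      have e := hw.integral_test_mul_sub hu hg h hsub hφ hc hs
      simp only [Pi.sub_apply, smul_eq_mul, mul_sub (φ _) (_ - _)]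
      rw [integral_sub, e, sub_self]
      · exact k1.bdd_mul (c := C) hφ.continuous.aestronglyMeasurable (ae_of_all _ hC)
      · exact k2.bdd_mul (c := C) hφ.continuous.aestronglyMeasurable (ae_of_all _ hC))
  filter_upwards [this] with x hx hxΩ
  exact sub_eq_zero.1 (hx hxΩ)

/-! ### Boundedness of the nonlocal derivative -/

theorem eLpNorm_lintegral_enorm_sub_mul_le {p : ℝ≥0∞} (hp : 1 ≤ p) {v : Space d → ℝ}
    (hv : StronglyMeasurable v) {κ : Space d → ℝ} (hκ : Integrable κ) :
    eLpNorm (fun x => ∫⁻ z, ‖v (x + z) - v x‖ₑ * ‖κ z‖ₑ) p volume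
      ≤ (∫⁻ z, ‖κ z‖ₑ) * (2 * eLpNorm v p volume) := by
  have hm := hv.measurable
  refine eLpNorm_lintegral_mul_le hp (F := fun x z => ‖v (x + z) - v x‖ₑ) ?_
    hκ.1.enorm hκ.2.ne (ae_of_all _ fun z _ => ?_)
  · exact ((hm.comp (measurable_fst.add measurable_snd)).sub (hm.comp measurable_fst)).enorm
  · have hz : eLpNorm (fun x => v (x + z)) p volume = eLpNorm v p volume :=
      eLpNorm_comp_measurePreserving hv.aestronglyMeasurable (measurePreserving_add_right volume z)
    calc eLpNorm (fun x => ‖v (x + z) - v x‖ₑ) p volume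
        = eLpNorm (fun x => v (x + z) - v x) p volume := eLpNorm_enorm _
      _ ≤ eLpNorm (fun x => v (x + z)) p volume + eLpNorm v p volume :=
          eLpNorm_sub_le (hm.comp (measurable_add_const z)).aestronglyMeasurable
            hv.aestronglyMeasurable hp
      _ = 2 * eLpNorm v p volume := by rw [hz, two_mul]

/-- On `Ω` the nonlocal derivative sees only the class of `u` in `L^p(Ω_δ)`: the points at which
`x + z` leaves `Ω_δ` are outside the support of the kernel. -/
theorem integrand_ae_congr {Ω : Set (Space d)} (hΩ : MeasurableSet Ω) {δ : ℝ}
    {κ : Space d → ℝ} (hU : MeasurableSet (nonlocalDomain Ω δ))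
    (hs : ∀ᵐ z, z ∉ Metric.closedBall (0 : Space d) δ → κ z = 0)
    {u v : Space d → ℝ} (h : u =ᵐ[leb (nonlocalDomain Ω δ)] v) :
    ∀ᵐ x ∂leb Ω, integrand κ u x =ᵐ[volume] integrand κ v x := by
  have h0 := ae_restrict_of_ae_restrict_of_subset (subset_nonlocalDomain Ω δ) h
  rw [EventuallyEq, ae_restrict_iff' hU] at h
  filter_upwards [h0, ae_restrict_mem hΩ] with x hx hxΩ
  have hq := (measurePreserving_add_left volume x).quasiMeasurePreserving.ae h
  filter_upwards [hq, hs] with z hz hsz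
  by_cases hzδ : z ∈ Metric.closedBall (0 : Space d) δ
  · have := hz (add_mem_nonlocalDomain hxΩ (by simpa using hzδ))
    simp only [integrand, this, hx]
  · simp [integrand, hsz hzδ]

theorem nonlocalDeriv_ae_congr {Ω : Set (Space d)} (hΩ : MeasurableSet Ω) {δ : ℝ}
    {κ : Space d → ℝ} (hU : MeasurableSet (nonlocalDomain Ω δ))
    (hs : ∀ᵐ z, z ∉ Metric.closedBall (0 : Space d) δ → κ z = 0)
    {u v : Space d → ℝ} (h : u =ᵐ[leb (nonlocalDomain Ω δ)] v) :
    nonlocalDeriv κ u =ᵐ[leb Ω] nonlocalDeriv κ v := by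
  filter_upwards [integrand_ae_congr hΩ hU hs h] with x hx
  exact integral_congr_ae hx

theorem aestronglyMeasurable_integrand {v : Space d → ℝ} (hv : StronglyMeasurable v)
    {κ : Space d → ℝ} (hκ : AEStronglyMeasurable κ) :
    AEStronglyMeasurable (Function.uncurry (integrand κ v))
      ((volume : Measure (Space d)).prod volume) := by
  refine AEStronglyMeasurable.mul ?_ (hκ.comp_snd)
  have hm := hv.measurable
  exact ((hm.comp (measurable_fst.add measurable_snd)).sub
    (hm.comp measurable_fst)).aestronglyMeasurable

theorem ae_integrable_integrand_of_stronglyMeasurable {p : ℝ≥0∞} (hp : 1 ≤ p) {v : Space d → ℝ}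
    (hv : StronglyMeasurable v) (hvp : eLpNorm v p volume ≠ ∞) {κ : Space d → ℝ}
    (hκ : Integrable κ) : ∀ᵐ x, Integrable (integrand κ v x) := by
  have h1 := eLpNorm_lintegral_enorm_sub_mul_le hp hv hκ
  have h2 : ∀ᵐ x, ∫⁻ z, ‖integrand κ v x z‖ₑ < ∞ := by
    simp only [integrand, enorm_mul]
    refine ae_lt_top_of_eLpNorm_ne_top (zero_lt_one.trans_le hp).ne' ?_
      (h1.trans_lt (ENNReal.mul_lt_top hκ.2 (ENNReal.mul_lt_top (by simp) hvp.lt_top))).ne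
    have := (aestronglyMeasurable_integrand hv hκ.1).enorm.lintegral_prod_right'
    simpa only [Function.uncurry, integrand, enorm_mul] using this
  filter_upwards [h2, (aestronglyMeasurable_integrand hv hκ.1).prodMk_left] with x hx hxm
  exact ⟨hxm, hx⟩

section Bounded

variable {Ω : Set (Space d)} {δ : ℝ} {p : ℝ≥0∞} {κ u : Space d → ℝ}

theorem ae_integrable_integrand (hp : 1 ≤ p) (hΩ : MeasurableSet Ω)
    (hU : MeasurableSet (nonlocalDomain Ω δ)) (hκ : Integrable κ)
    (hs : ∀ᵐ z, z ∉ Metric.closedBall (0 : Space d) δ → κ z = 0)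
    (hu : MemLp u p (leb (nonlocalDomain Ω δ))) :
    ∀ᵐ x ∂leb Ω, Integrable (integrand κ u x) := by
  obtain ⟨v, hv, hvu, hvp, -, -⟩ := hu.exists_stronglyMeasurable_extension hU
  filter_upwards [integrand_ae_congr hΩ hU hs hvu,
    ae_restrict_of_ae (ae_integrable_integrand_of_stronglyMeasurable hp hv hvp.2.ne hκ)]
    with x hx hxi
  exact hxi.congr hx

theorem aestronglyMeasurable_nonlocalDeriv (hΩ : MeasurableSet Ω)
    (hU : MeasurableSet (nonlocalDomain Ω δ)) (hκ : Integrable κ)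
    (hs : ∀ᵐ z, z ∉ Metric.closedBall (0 : Space d) δ → κ z = 0)
    (hu : MemLp u p (leb (nonlocalDomain Ω δ))) :
    AEStronglyMeasurable (nonlocalDeriv κ u) (leb Ω) := by
  obtain ⟨v, hv, hvu, hvp, -, -⟩ := hu.exists_stronglyMeasurable_extension hU
  refine AEStronglyMeasurable.congr ?_ (nonlocalDeriv_ae_congr hΩ hU hs hvu)
  exact (aestronglyMeasurable_integrand hv hκ.1).integral_prod_right'.restrict

theorem eLpNorm_nonlocalDeriv_le (hp : 1 ≤ p) (hΩ : MeasurableSet Ω)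
    (hU : MeasurableSet (nonlocalDomain Ω δ)) (hκ : Integrable κ)
    (hs : ∀ᵐ z, z ∉ Metric.closedBall (0 : Space d) δ → κ z = 0)
    (hu : MemLp u p (leb (nonlocalDomain Ω δ))) :
    eLpNorm (nonlocalDeriv κ u) p (leb Ω)
      ≤ (∫⁻ z, ‖κ z‖ₑ) * (2 * eLpNorm u p (leb (nonlocalDomain Ω δ))) := by
  obtain ⟨v, hv, hvu, hvp, hvn, -⟩ := hu.exists_stronglyMeasurable_extension hU
  rw [← eLpNorm_congr_ae (nonlocalDeriv_ae_congr hΩ hU hs hvu), ← hvn]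
  refine le_trans ?_ (eLpNorm_lintegral_enorm_sub_mul_le hp hv hκ)
  refine (eLpNorm_mono_measure _ Measure.restrict_le_self).trans ?_
  refine eLpNorm_mono_enorm fun x => (enorm_integral_le_lintegral_enorm _).trans_eq ?_
  simp only [integrand, enorm_mul, enorm_eq_self]

theorem memLp_extNonlocalDeriv (hp : 1 ≤ p) (hΩ : MeasurableSet Ω)
    (hU : MeasurableSet (nonlocalDomain Ω δ)) (hκ : Integrable κ)
    (hs : ∀ᵐ z, z ∉ Metric.closedBall (0 : Space d) δ → κ z = 0)
    (hu : MemLp u p (leb (nonlocalDomain Ω δ))) :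
    MemLp (extNonlocalDeriv Ω κ u) p (leb (nonlocalDomain Ω δ)) := by
  rw [extNonlocalDeriv, memLp_indicator_iff_restrict hΩ, leb,
    Measure.restrict_restrict_of_subset (subset_nonlocalDomain Ω δ)]
  exact ⟨aestronglyMeasurable_nonlocalDeriv hΩ hU hκ hs hu,
    (eLpNorm_nonlocalDeriv_le hp hΩ hU hκ hs hu).trans_lt
      (ENNReal.mul_lt_top hκ.2 (ENNReal.mul_lt_top (by simp) hu.2))⟩

theorem eLpNorm_extNonlocalDeriv_le (hp : 1 ≤ p) (hΩ : MeasurableSet Ω)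
    (hU : MeasurableSet (nonlocalDomain Ω δ)) (hκ : Integrable κ)
    (hs : ∀ᵐ z, z ∉ Metric.closedBall (0 : Space d) δ → κ z = 0)
    (hu : MemLp u p (leb (nonlocalDomain Ω δ))) :
    eLpNorm (extNonlocalDeriv Ω κ u) p (leb (nonlocalDomain Ω δ))
      ≤ (∫⁻ z, ‖κ z‖ₑ) * (2 * eLpNorm u p (leb (nonlocalDomain Ω δ))) := by
  refine le_trans (le_of_eq ?_) (eLpNorm_nonlocalDeriv_le hp hΩ hU hκ hs hu)
  rw [extNonlocalDeriv, eLpNorm_indicator_eq_eLpNorm_restrict hΩ, leb,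
    Measure.restrict_restrict_of_subset (subset_nonlocalDomain Ω δ)]

theorem extNonlocalDeriv_ae_congr (hΩ : MeasurableSet Ω)
    (hU : MeasurableSet (nonlocalDomain Ω δ))
    (hs : ∀ᵐ z, z ∉ Metric.closedBall (0 : Space d) δ → κ z = 0) {v : Space d → ℝ}
    (h : u =ᵐ[leb (nonlocalDomain Ω δ)] v) :
    extNonlocalDeriv Ω κ u =ᵐ[leb (nonlocalDomain Ω δ)] extNonlocalDeriv Ω κ v := by
  have := (ae_restrict_iff' hΩ).1 (nonlocalDeriv_ae_congr hΩ hU hs h)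
  refine ae_restrict_of_ae ?_
  filter_upwards [this] with x hx
  by_cases hxΩ : x ∈ Ω
  · simp [extNonlocalDeriv, hxΩ, hx hxΩ]
  · simp [extNonlocalDeriv, hxΩ]

theorem extNonlocalDeriv_add (hp : 1 ≤ p) (hΩ : MeasurableSet Ω)
    (hU : MeasurableSet (nonlocalDomain Ω δ)) (hκ : Integrable κ)
    (hs : ∀ᵐ z, z ∉ Metric.closedBall (0 : Space d) δ → κ z = 0) {v : Space d → ℝ}
    (hu : MemLp u p (leb (nonlocalDomain Ω δ))) (hv : MemLp v p (leb (nonlocalDomain Ω δ))) :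
    extNonlocalDeriv Ω κ (u + v) =ᵐ[leb (nonlocalDomain Ω δ)]
      extNonlocalDeriv Ω κ u + extNonlocalDeriv Ω κ v := by
  have hu' := (ae_restrict_iff' hΩ).1 (ae_integrable_integrand hp hΩ hU hκ hs hu)
  have hv' := (ae_restrict_iff' hΩ).1 (ae_integrable_integrand hp hΩ hU hκ hs hv)
  refine ae_restrict_of_ae ?_
  filter_upwards [hu', hv'] with x hxu hxv
  by_cases hxΩ : x ∈ Ω
  · simp only [extNonlocalDeriv, hxΩ, Set.indicator_of_mem, Pi.add_apply, nonlocalDeriv]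
    rw [← integral_add (hxu hxΩ) (hxv hxΩ)]
    congr 1; ext z
    simp only [integrand, Pi.add_apply]; ring
  · simp [extNonlocalDeriv, hxΩ]

theorem extNonlocalDeriv_smul (c : ℝ) :
    extNonlocalDeriv Ω κ (c • u) = c • extNonlocalDeriv Ω κ u := by
  ext x
  by_cases hxΩ : x ∈ Ω
  · simp only [extNonlocalDeriv, hxΩ, Set.indicator_of_mem, Pi.smul_apply, nonlocalDeriv,
      smul_eq_mul]
    rw [← integral_const_mul]
    congr 1; ext z
    simp only [integrand, Pi.smul_apply, smul_eq_mul]; ring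
  · simp [extNonlocalDeriv, hxΩ]

/-- The extended nonlocal derivative, as a bounded operator on `L^p(Ω_δ)`. -/
theorem exists_continuousLinearMap_extNonlocalDeriv [Fact (1 ≤ p)] (hΩ : MeasurableSet Ω)
    (hU : MeasurableSet (nonlocalDomain Ω δ)) (hκ : Integrable κ)
    (hs : ∀ᵐ z, z ∉ Metric.closedBall (0 : Space d) δ → κ z = 0) :
    ∃ T : Lp ℝ p (leb (nonlocalDomain Ω δ)) →L[ℝ] Lp ℝ p (leb (nonlocalDomain Ω δ)),
      ∀ (u : Space d → ℝ) (hu : MemLp u p (leb (nonlocalDomain Ω δ))),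
        T (hu.toLp u) =ᵐ[leb (nonlocalDomain Ω δ)] extNonlocalDeriv Ω κ u := by
  have hp : 1 ≤ p := Fact.out
  have hmem := fun f : Lp ℝ p (leb (nonlocalDomain Ω δ)) =>
    memLp_extNonlocalDeriv hp hΩ hU hκ hs (Lp.memLp f)
  let L : Lp ℝ p (leb (nonlocalDomain Ω δ)) →ₗ[ℝ] Lp ℝ p (leb (nonlocalDomain Ω δ)) :=
    { toFun := fun f => (hmem f).toLp _
      map_add' := fun f g => by
        rw [← MemLp.toLp_add, MemLp.toLp_eq_toLp_iff]
        exact (extNonlocalDeriv_ae_congr hΩ hU hs (Lp.coeFn_add f g)).trans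
          (extNonlocalDeriv_add hp hΩ hU hκ hs (Lp.memLp f) (Lp.memLp g))
      map_smul' := fun c f => by
        rw [RingHom.id_apply, ← MemLp.toLp_const_smul, MemLp.toLp_eq_toLp_iff]
        exact (extNonlocalDeriv_ae_congr hΩ hU hs (Lp.coeFn_smul c f)).trans
          (extNonlocalDeriv_smul c).eventuallyEq }
  refine ⟨L.mkContinuous ((∫⁻ z, ‖κ z‖ₑ).toReal * 2) fun f => ?_, fun u hu => ?_⟩
  · have h := eLpNorm_extNonlocalDeriv_le hp hΩ hU hκ hs (Lp.memLp f)
    have h' := ENNReal.toReal_mono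
      (ENNReal.mul_ne_top hκ.2.ne (ENNReal.mul_ne_top (by simp) (Lp.memLp f).2.ne)) h
    rw [ENNReal.toReal_mul, ENNReal.toReal_mul, ← mul_assoc, ENNReal.toReal_ofNat,
      ← Lp.norm_def] at h'
    rw [show L f = (hmem f).toLp _ from rfl, Lp.norm_toLp]
    exact h'
  · exact (MemLp.coeFn_toLp (hmem (hu.toLp u))).trans
      (extNonlocalDeriv_ae_congr hΩ hU hs hu.coeFn_toLp)

end Bounded

/-! ### Translations in `L^p` -/

/-- The `L^p` modulus of continuity of `g`: the supremum of the `L^p` distances between `g` and its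
translates by vectors of norm at most `δ`. -/
noncomputable def translationModulus {E : Type*} [NormedAddCommGroup E] (p : ℝ≥0∞)
    (g : Space d → E) (δ : ℝ) : ℝ≥0∞ :=
  ⨆ h ∈ Metric.closedBall (0 : Space d) δ, eLpNorm (fun x => g (x + h) - g x) p volume

theorem tendsto_translationModulus {E : Type*} [NormedAddCommGroup E] {p : ℝ≥0∞}
    [Fact (1 ≤ p)] (hpt : p ≠ ∞) {g : Space d → E} (hg : MemLp g p volume) :
    Tendsto (translationModulus p g) (𝓝[>] 0) (𝓝 0) := by
  have hmp : ∀ h : Space d, MeasurePreserving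
      ((ContinuousMap.mk (fun q : Space d × Space d => q.2 + q.1) (by fun_prop)).curry h)
      volume volume := fun h => measurePreserving_add_right volume h
  have hc : Continuous fun h : Space d => Lp.compMeasurePreserving _ (hmp h) (hg.toLp g) :=
    (continuous_const (y := hg.toLp g)).compMeasurePreservingLp
      (ContinuousMap.continuous _) hmp hpt
  have hed := tendsto_iff_edist_tendsto_0.1 (hc.tendsto 0)
  have hval : ∀ h : Space d, edist (Lp.compMeasurePreserving _ (hmp h) (hg.toLp g))
      (Lp.compMeasurePreserving _ (hmp 0) (hg.toLp g))
        = eLpNorm (fun x => g (x + h) - g x) p volume := by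
    intro h
    rw [Lp.edist_def]
    refine eLpNorm_congr_ae ?_
    have hq : ∀ h : Space d, Lp.compMeasurePreserving _ (hmp h) (hg.toLp g)
        =ᵐ[volume] fun x => g (x + h) := fun h =>
      (Lp.coeFn_compMeasurePreserving _ (hmp h)).trans
        ((hmp h).quasiMeasurePreserving.ae_eq_comp hg.coeFn_toLp)
    filter_upwards [hq h, hq 0] with x h1 h2
    exact (congrArg₂ (· - ·) h1 h2).trans (by rw [add_zero])
  simp_rw [hval] at hed
  rw [ENNReal.tendsto_nhds_zero] at hed ⊢
  intro ε hε
  obtain ⟨r, hr, hball⟩ := Metric.eventually_nhds_iff_ball.1 (hed ε hε)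
  filter_upwards [Ioo_mem_nhdsGT hr] with δ hδ
  refine iSup₂_le fun h hh => hball h ?_
  exact Metric.closedBall_subset_ball hδ.2 hh

/-! ### Convergence to the local derivative -/

/-- The first-order Taylor remainder of a weakly differentiable function, in `L^p`. -/
theorem IsWeakGradient.eLpNorm_sub_sub_inner_le {p : ℝ≥0∞} (hp : 1 ≤ p) {U : Set (Space d)}
    {u : Space d → ℝ} {g : Space d → Space d} (hw : IsWeakGradient U u g) (hu : Integrable u)
    (hg : Integrable g) (hgm : StronglyMeasurable g) {Ω : Set (Space d)} (hΩ : IsOpen Ω)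
    {δ : ℝ} (hΩU : nonlocalDomain Ω δ ⊆ U) {h : Space d} (hh : ‖h‖ ≤ δ) :
    eLpNorm (fun x => u (x + h) - u x - inner ℝ (g x) h) p (leb Ω)
      ≤ ‖h‖ₑ * translationModulus p g δ := by
  set T : Measure ℝ := volume.restrict (Set.Ioc (0 : ℝ) 1) with hT
  have hT1 : T Set.univ = 1 := by simp [hT]
  have hth : ∀ t ∈ Set.Icc (0 : ℝ) 1, ‖t • h‖ ≤ δ := fun t ht => by
    rw [norm_smul, Real.norm_of_nonneg ht.1]
    exact (mul_le_of_le_one_left (norm_nonneg h) ht.2).trans hh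
  have hid := (ae_restrict_iff' hΩ.measurableSet).2 (hw.ae_sub_eq_integral hu hg hΩ h
    fun t ht x hx => hΩU (add_mem_nonlocalDomain hx (hth t ht)))
  have hin : Integrable fun x => (inner ℝ (g x) h : ℝ) := hg.inner_const h
  have hti : ∀ᵐ x, Integrable (fun t : ℝ => (inner ℝ (g (x + t • h)) h : ℝ)) T :=
    (integrable_comp_add_smul_prod hin T h).prod_left_ae
  have hm : Measurable (Function.uncurry fun (x : Space d) (t : ℝ) =>
      ‖g (x + t • h) - g x‖ₑ * ‖h‖ₑ) := by
    have hgm' := hgm.measurable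
    have a1 : Measurable fun q : Space d × ℝ => q.1 + q.2 • h := by fun_prop
    exact ((hgm'.comp a1).sub (hgm'.comp measurable_fst)).enorm.mul_const _
  have hpt : ∀ᵐ x ∂leb Ω, ‖u (x + h) - u x - inner ℝ (g x) h‖ₑ
      ≤ ‖∫⁻ t, ‖g (x + t • h) - g x‖ₑ * ‖h‖ₑ ∂T‖ₑ := by
    filter_upwards [hid, ae_restrict_of_ae hti] with x hx hxi
    have e : u (x + h) - u x - inner ℝ (g x) h = ∫ t, inner ℝ (g (x + t • h) - g x) h ∂T := by
      simp_rw [inner_sub_left]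
      rw [hx, integral_sub hxi (integrable_const _), integral_const, measureReal_def, hT1,
        ENNReal.toReal_one, one_smul]
    rw [e, enorm_eq_self]
    refine (enorm_integral_le_lintegral_enorm _).trans (lintegral_mono fun t => ?_)
    exact enorm_inner_le_enorm _ _
  refine (eLpNorm_mono_enorm_ae hpt).trans ?_
  refine (eLpNorm_lintegral_le hp hm (K := ‖h‖ₑ * translationModulus p g δ) ?_).trans_eq
    (by rw [hT1, one_mul])
  refine (ae_restrict_iff' measurableSet_Ioc).2 (ae_of_all _ fun t ht => ?_)
  have e2 : eLpNorm (fun x => ‖g (x + t • h) - g x‖ₑ * ‖h‖ₑ) p (leb Ω)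
      = ‖h‖ₑ * eLpNorm (fun x => g (x + t • h) - g x) p (leb Ω) := by
    rw [← enorm_norm h, ← eLpNorm_const_smul]
    refine eLpNorm_congr_enorm_ae (ae_of_all _ fun x => ?_)
    rw [Pi.smul_apply, enorm_smul, enorm_eq_self, mul_comm]
  rw [e2]
  gcongr
  refine (eLpNorm_mono_measure _ Measure.restrict_le_self).trans ?_
  exact le_iSup₂_of_le (t • h) (by simpa using hth t ⟨ht.1.le, ht.2⟩) le_rfl

/-- The quantitative form of the convergence: the error of the nonlocal derivative is controlled by
the modulus of continuity of the gradient in `L^p` and by the error in the first moment of the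
kernel. -/
theorem IsWeakGradient.eLpNorm_nonlocalDeriv_sub_le {p : ℝ≥0∞} (hp : 1 ≤ p) {U : Set (Space d)}
    {u : Space d → ℝ} {g : Space d → Space d} (hw : IsWeakGradient U u g) (hu : Integrable u)
    (hum : StronglyMeasurable u) (hup : MemLp u p)
    (hg : Integrable g) (hgm : StronglyMeasurable g) {Ω : Set (Space d)} (hΩ : IsOpen Ω)
    {δ : ℝ} (hΩU : nonlocalDomain Ω δ ⊆ U) {κ : Space d → ℝ} (hκ : Integrable κ)
    (hs : ∀ᵐ z, z ∉ Metric.closedBall (0 : Space d) δ → κ z = 0)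
    (hκ1 : Integrable fun z => |κ z| * ‖z‖) (a : Space d) :
    eLpNorm (fun x => nonlocalDeriv κ u x - inner ℝ (g x) a) p (leb Ω)
      ≤ ENNReal.ofReal (∫ z, |κ z| * ‖z‖) * translationModulus p g δ
        + ‖(∫ z, κ z • z) - a‖ₑ * eLpNorm g p volume := by
  have humm := hum.measurable
  have hgmm := hgm.measurable
  have hw1 : ∀ z, ‖κ z‖ₑ * ‖z‖ₑ = ‖|κ z| * ‖z‖‖ₑ := fun z => by
    rw [enorm_mul, enorm_norm, Real.enorm_abs]
  have hmass : ∫⁻ z, ‖κ z‖ₑ * ‖z‖ₑ = ENNReal.ofReal (∫ z, |κ z| * ‖z‖) := by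
    simp_rw [hw1]
    rw [ofReal_integral_eq_lintegral_ofReal hκ1 (ae_of_all _ fun z => by positivity)]
    exact lintegral_congr fun z => Real.enorm_of_nonneg (by positivity)
  have hκz : Integrable fun z => κ z • z := by
    refine (integrable_norm_iff (hκ.1.smul aestronglyMeasurable_id)).1 ?_
    simpa only [Pi.smul_apply', id, norm_smul, Real.norm_eq_abs] using hκ1
  -- The Taylor remainder of `u`, divided by `‖z‖`, is integrated against `|κ z| ‖z‖`.
  have hrem : eLpNorm (fun x => ∫⁻ z, ‖u (x + z) - u x - inner ℝ (g x) z‖ₑ * ‖κ z‖ₑ) p (leb Ω)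
      ≤ ENNReal.ofReal (∫ z, |κ z| * ‖z‖) * translationModulus p g δ := by
    rw [← hmass]
    have hF : Measurable (Function.uncurry fun x z : Space d =>
        ‖u (x + z) - u x - inner ℝ (g x) z‖ₑ * ‖z‖ₑ⁻¹) := by
      have a1 : Measurable fun q : Space d × Space d => (inner ℝ (g q.1) q.2 : ℝ) :=
        (hgmm.comp measurable_fst).inner measurable_snd
      exact (((humm.comp (measurable_fst.add measurable_snd)).sub
        (humm.comp measurable_fst)).sub a1).enorm.mul measurable_snd.enorm.inv
    refine le_trans (le_of_eq ?_) (eLpNorm_lintegral_mul_le (μ := leb Ω) hp hF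
      (w := fun z => ‖κ z‖ₑ * ‖z‖ₑ) (hκ.1.enorm.mul measurable_id.enorm.aemeasurable)
      (by rw [hmass]; exact ENNReal.ofReal_ne_top) (K := translationModulus p g δ) ?_)
    · congr 1; ext x
      refine lintegral_congr fun z => ?_
      rcases eq_or_ne z 0 with rfl | hz
      · simp
      · rw [mul_comm ‖κ z‖ₑ, mul_assoc, ← mul_assoc ‖z‖ₑ⁻¹,
          ENNReal.inv_mul_cancel (by simpa using hz) enorm_ne_top, one_mul]
    · filter_upwards [hs] with z hz hz0
      have hz1 : z ≠ 0 := by rintro rfl; simp at hz0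
      have hzδ : ‖z‖ ≤ δ := by
        by_contra hcon
        exact hz0 (by rw [hz (by simpa using hcon)]; simp)
      have hzt : ‖z‖ₑ⁻¹ ≠ ∞ := by simpa using hz1
      have e2 : eLpNorm (fun x => ‖u (x + z) - u x - inner ℝ (g x) z‖ₑ * ‖z‖ₑ⁻¹) p (leb Ω)
          = ‖z‖ₑ⁻¹ * eLpNorm (fun x => u (x + z) - u x - inner ℝ (g x) z) p (leb Ω) := by
        have e3 : ‖z‖ₑ⁻¹ = ‖(‖z‖⁻¹ : ℝ)‖ₑ := by
          rw [enorm_inv (by simpa using hz1), enorm_norm]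
        rw [e3, ← eLpNorm_const_smul]
        refine eLpNorm_congr_enorm_ae (ae_of_all _ fun x => ?_)
        rw [Pi.smul_apply, enorm_smul, enorm_eq_self, mul_comm]
      rw [e2]
      calc ‖z‖ₑ⁻¹ * eLpNorm (fun x => u (x + z) - u x - inner ℝ (g x) z) p (leb Ω)
          ≤ ‖z‖ₑ⁻¹ * (‖z‖ₑ * translationModulus p g δ) := by
            gcongr
            exact hw.eLpNorm_sub_sub_inner_le hp hu hg hgm hΩ hΩU hzδ
        _ = translationModulus p g δ := by
            rw [← mul_assoc, ENNReal.inv_mul_cancel (by simpa using hz1) enorm_ne_top, one_mul]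
  have hsplit : ∀ᵐ x ∂leb Ω, nonlocalDeriv κ u x - inner ℝ (g x) a
      = (∫ z, (u (x + z) - u x - inner ℝ (g x) z) * κ z)
        + inner ℝ (g x) ((∫ z, κ z • z) - a) := by
    filter_upwards [ae_restrict_of_ae
      (ae_integrable_integrand_of_stronglyMeasurable hp hum hup.2.ne hκ)] with x hx
    have i2 : Integrable fun z => (inner ℝ (g x) (κ z • z) : ℝ) := hκz.const_inner (g x)
    have e : (fun z => (u (x + z) - u x - inner ℝ (g x) z) * κ z)
        = fun z => integrand κ u x z - inner ℝ (g x) (κ z • z) := by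
      ext z
      rw [integrand, inner_smul_right]; ring
    rw [e, integral_sub hx i2, integral_inner hκz, inner_sub_right, nonlocalDeriv]
    ring
  have hm1 : AEStronglyMeasurable
      (fun x => ∫ z, (u (x + z) - u x - inner ℝ (g x) z) * κ z) (leb Ω) := by
    have a1 : Measurable fun q : Space d × Space d => (inner ℝ (g q.1) q.2 : ℝ) :=
      (hgmm.comp measurable_fst).inner measurable_snd
    have a2 : AEStronglyMeasurable
        (fun q : Space d × Space d => (u (q.1 + q.2) - u q.1 - inner ℝ (g q.1) q.2) * κ q.2)
        ((leb Ω).prod volume) :=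
      (((humm.comp (measurable_fst.add measurable_snd)).sub
        (humm.comp measurable_fst)).sub a1).aestronglyMeasurable.mul hκ.1.comp_snd
    exact a2.integral_prod_right'
  have hm2 : AEStronglyMeasurable
      (fun x => (inner ℝ (g x) ((∫ z, κ z • z) - a) : ℝ)) (leb Ω) :=
    (hgmm.inner measurable_const).aestronglyMeasurable
  rw [eLpNorm_congr_ae hsplit]
  refine (eLpNorm_add_le hm1 hm2 hp).trans (add_le_add ?_ ?_)
  · refine le_trans (eLpNorm_mono_enorm fun x => ?_) hrem
    rw [enorm_eq_self]
    refine (enorm_integral_le_lintegral_enorm _).trans_eq ?_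
    simp only [enorm_mul]
  · rw [← enorm_norm ((∫ z, κ z • z) - a), ← eLpNorm_const_smul]
    refine (eLpNorm_mono_measure _ Measure.restrict_le_self).trans
      (eLpNorm_mono_enorm fun x => ?_)
    rw [Pi.smul_apply, enorm_smul, enorm_norm, mul_comm]
    exact enorm_inner_le_enorm _ _

theorem tendsto_eLpNorm_extNonlocalDeriv_sub {p : ℝ≥0∞} [Fact (1 ≤ p)] (hpt : p ≠ ∞)
    {Ω : Set (Space d)} (hΩ : IsOpen Ω) (hΩb : Bornology.IsBounded Ω)
    {κ : ℝ → Space d → ℝ} (hκ : ∀ δ > 0, Integrable (κ δ))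
    (hs : ∀ δ > 0, ∀ᵐ z, z ∉ Metric.closedBall (0 : Space d) δ → κ δ z = 0)
    {a : Space d} (hmom : MomentHypotheses κ a) {δ₀ : ℝ} (hδ₀ : 0 < δ₀)
    {u : Space d → ℝ} {g : Space d → Space d} (hug : MemW1p (nonlocalDomain Ω δ₀) p u g) :
    Tendsto (fun δ : ℝ => eLpNorm
      (fun x => extNonlocalDeriv Ω (κ δ) u x - inner ℝ (g x) a) p (leb Ω)) (𝓝[>] 0) (𝓝 0) := by
  have hp : 1 ≤ p := Fact.out
  have hU := (isOpen_nonlocalDomain hΩ hδ₀.le).measurableSet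
  obtain ⟨v, hv, hvu, hvp, -, hv0⟩ := hug.memLp.exists_stronglyMeasurable_extension hU
  obtain ⟨f, hf, hfg, hfp, -, hf0⟩ := hug.memLp_grad.exists_stronglyMeasurable_extension hU
  have hfin : IsFiniteMeasure (leb (nonlocalDomain Ω δ₀)) :=
    ⟨by simpa using (isBounded_nonlocalDomain hΩb hδ₀.le).measure_lt_top⟩
  -- The representatives vanish outside a bounded set, so that being in `L^p` makes them integrable.
  have hvi : Integrable v :=
    (integrableOn_iff_integrable_of_support_subset
      (fun x hx => by by_contra h; exact hx (hv0 x h))).1 ((hvp.restrict _).integrable hp)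
  have hfi : Integrable f :=
    (integrableOn_iff_integrable_of_support_subset
      (fun x hx => by by_contra h; exact hx (hf0 x h))).1 ((hfp.restrict _).integrable hp)
  have hw := hug.weakGradient.congr hvu.symm hfg.symm
  obtain ⟨M, hM⟩ := hmom.boundedMoments
  obtain ⟨ω, hωc, -, -, hω0, hω, -⟩ := hmom.modulus
  have hbound : ∀ᶠ δ in 𝓝[>] (0 : ℝ), eLpNorm
      (fun x => extNonlocalDeriv Ω (κ δ) u x - inner ℝ (g x) a) p (leb Ω)
      ≤ ENNReal.ofReal M * translationModulus p f δ
        + ENNReal.ofReal (ω δ) * eLpNorm f p volume := by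
    filter_upwards [Ioo_mem_nhdsGT hδ₀] with δ hδ
    have hsub := nonlocalDomain_mono Ω hδ.1.le hδ.2.le
    have hUδ := (isOpen_nonlocalDomain hΩ hδ.1.le).measurableSet
    have hcongr : (fun x => extNonlocalDeriv Ω (κ δ) u x - inner ℝ (g x) a)
        =ᵐ[leb Ω] fun x => nonlocalDeriv (κ δ) v x - inner ℝ (f x) a := by
      filter_upwards [ae_restrict_mem hΩ.measurableSet,
        nonlocalDeriv_ae_congr hΩ.measurableSet hUδ (hs δ hδ.1)
          (ae_restrict_of_ae_restrict_of_subset hsub hvu),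
        ae_restrict_of_ae_restrict_of_subset (subset_nonlocalDomain Ω δ₀) hfg] with x h1 h2 h3
      rw [extNonlocalDeriv, Set.indicator_of_mem h1, h2, h3]
    rw [eLpNorm_congr_ae hcongr]
    refine (hw.eLpNorm_nonlocalDeriv_sub_le hp hvi hv hvp hfi hf hΩ hsub (hκ δ hδ.1)
      (hs δ hδ.1) (hM δ hδ.1).1 a).trans ?_
    gcongr
    · exact (hM δ hδ.1).2.le
    · rw [← ofReal_norm]
      exact ENNReal.ofReal_le_ofReal (hω δ hδ.1)
  have hωt : Tendsto ω (𝓝[>] 0) (𝓝 0) := by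
    have := (hωc 0 Set.self_mem_Ici).mono_left (nhdsWithin_mono 0 Set.Ioi_subset_Ici_self)
    rwa [hω0] at this
  have h1 := ENNReal.Tendsto.const_mul (a := ENNReal.ofReal M)
    (tendsto_translationModulus hpt hfp) (Or.inr ENNReal.ofReal_ne_top)
  have h2 := ENNReal.Tendsto.mul_const (b := eLpNorm f p volume)
    (ENNReal.tendsto_ofReal hωt) (Or.inr hfp.2.ne)
  have h3 := h1.add h2
  rw [ENNReal.ofReal_zero, zero_mul, mul_zero, add_zero] at h3
  exact tendsto_of_tendsto_of_tendsto_of_le_of_le' tendsto_const_nhds h3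
    (Eventually.of_forall fun _ => zero_le) hbound

theorem eventually_aestronglyMeasurable_extNonlocalDeriv_sub {p : ℝ≥0∞}
    {Ω : Set (Space d)} (hΩ : IsOpen Ω)
    {κ : ℝ → Space d → ℝ} (hκ : ∀ δ > 0, Integrable (κ δ))
    (hs : ∀ δ > 0, ∀ᵐ z, z ∉ Metric.closedBall (0 : Space d) δ → κ δ z = 0)
    (a : Space d) {δ₀ : ℝ} (hδ₀ : 0 < δ₀)
    {u : Space d → ℝ} {g : Space d → Space d} (hug : MemW1p (nonlocalDomain Ω δ₀) p u g) :
    ∀ᶠ δ in 𝓝[>] (0 : ℝ), AEStronglyMeasurable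
      (fun x => extNonlocalDeriv Ω (κ δ) u x - inner ℝ (g x) a) (leb Ω) := by
  filter_upwards [Ioo_mem_nhdsGT hδ₀] with δ hδ
  have hUδ := (isOpen_nonlocalDomain hΩ hδ.1.le).measurableSet
  have huδ := hug.memLp.mono_measure
    (Measure.restrict_mono (nonlocalDomain_mono Ω hδ.1.le hδ.2.le) le_rfl)
  refine AEStronglyMeasurable.sub ?_ ?_
  · exact (aestronglyMeasurable_nonlocalDeriv hΩ.measurableSet hUδ (hκ δ hδ.1)
      (hs δ hδ.1) huδ).congr (by
        filter_upwards [ae_restrict_mem hΩ.measurableSet] with x hx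
        rw [extNonlocalDeriv, Set.indicator_of_mem hx])
  · exact (hug.memLp_grad.1.mono_measure
      (Measure.restrict_mono (subset_nonlocalDomain Ω δ₀) le_rfl)).inner aestronglyMeasurable_const

end NonlocalCalculus

open NonlocalCalculus

/-! ### Operators with several components -/

theorem mainTheorem8
    {d : ℕ} (Ω : Set (Space d)) (hΩ : IsOpen Ω) (hΩb : Bornology.IsBounded Ω)
    (p : ℝ≥0∞) [Fact (1 ≤ p)]
    (hext : ∀ δ > 0, IsExtensionDomain p (nonlocalDomain Ω δ))
    {m : ℕ} (c : Fin m → ℝ) (μ : ℝ → Fin m → Space d → ℝ)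
    (hμ : ∀ δ > 0, ∀ k, Integrable (μ δ k))
    (hsupp : ∀ δ > 0, ∀ k, ∀ᵐ z, z ∉ Metric.closedBall (0 : Space d) δ →
      μ δ k z = 0)
    (hmom : ∀ (k : Fin m) (hk : (k : ℕ) < d),
      MomentHypotheses (fun δ => μ δ k) (stdBasis ⟨k, hk⟩)) :
    -- The integrals defining the operators converge absolutely, almost everywhere on `Ω`.
    (∀ δ > 0, ∀ u : Space d → ℝ,
      MemLp u p (leb (nonlocalDomain Ω δ)) →
      ∀ k, ∀ᵐ x ∂(leb Ω),
        Integrable (integrand (μ δ k) u x)) ∧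
    -- `𝒜_δ` is a bounded linear operator `L^p(Ω_δ) → L^p(Ω_δ)`.
    (∀ δ > 0, ∃ T : Lp ℝ p (leb (nonlocalDomain Ω δ)) →L[ℝ]
        Lp ℝ p (leb (nonlocalDomain Ω δ)),
      ∀ (u : Space d → ℝ)
        (hu : MemLp u p (leb (nonlocalDomain Ω δ))),
        T (hu.toLp u) =ᵐ[leb (nonlocalDomain Ω δ)]
          nonlocalOp Ω c (μ δ) u) ∧
    -- `𝒢_δ` is a bounded linear operator `L^p(Ω_δ) → L^p(Ω_δ)^m`.
    (∀ δ > 0, ∃ T : Lp ℝ p (leb (nonlocalDomain Ω δ)) →L[ℝ]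
        (Fin m → Lp ℝ p (leb (nonlocalDomain Ω δ))),
      ∀ (u : Space d → ℝ)
        (hu : MemLp u p (leb (nonlocalDomain Ω δ))),
        ∀ k, T (hu.toLp u) k =ᵐ[leb (nonlocalDomain Ω δ)]
          fun x => nonlocalGrad Ω c (μ δ) u x k) ∧
    -- `𝒟_δ` is a bounded linear operator `L^p(Ω_δ)^m → L^p(Ω_δ)`.
    (∀ δ > 0, ∃ T : (Fin m → Lp ℝ p
          (leb (nonlocalDomain Ω δ))) →L[ℝ]
        Lp ℝ p (leb (nonlocalDomain Ω δ)),
      ∀ (v : Fin m → Space d → ℝ)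
        (hv : ∀ k, MemLp (v k) p (leb (nonlocalDomain Ω δ))),
        T (fun k => (hv k).toLp (v k))
            =ᵐ[leb (nonlocalDomain Ω δ)]
          nonlocalDiv Ω c (μ δ) v) ∧
    -- Convergence of `𝒜_δ u` to `∑_k c_k ∂_k u` in `L^p(Ω)`.
    (p ≠ ∞ → ∀ hm : m ≤ d, ∀ δ₀ > 0,
      ∀ (u : Space d → ℝ) (g : Space d → Space d),
        MemW1p (nonlocalDomain Ω δ₀) p u g →
        Tendsto (fun δ : ℝ => eLpNorm
            (fun x => nonlocalOp Ω c (μ δ) u x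
              - ∑ k, c k * g x (Fin.castLE hm k)) p (leb Ω))
          (𝓝[>] 0) (𝓝 0)) ∧
    -- Convergence of the nonlocal gradient to `∇u` in `L^p(Ω)^d`.
    (p ≠ ∞ → ∀ hm : m = d, (∀ k, c k = 1) → ∀ δ₀ > 0,
      ∀ (u : Space d → ℝ) (g : Space d → Space d),
        MemW1p (nonlocalDomain Ω δ₀) p u g →
        Tendsto (fun δ : ℝ => eLpNorm
            (fun x => (WithLp.toLp 2
                (fun k : Fin d => nonlocalGrad Ω c (μ δ) u x (Fin.cast hm.symm k)) :
                Space d) - g x) p (leb Ω))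
          (𝓝[>] 0) (𝓝 0)) ∧
    -- Convergence of the nonlocal divergence to `div v = ∑_k ∂_k v_k` in `L^p(Ω)`.
    (p ≠ ∞ → ∀ hm : m = d, (∀ k, c k = 1) → ∀ δ₀ > 0,
      ∀ (v : Fin m → Space d → ℝ)
        (g : Fin m → Space d → Space d),
        (∀ k, MemW1p (nonlocalDomain Ω δ₀) p (v k) (g k)) →
        Tendsto (fun δ : ℝ => eLpNorm
            (fun x => nonlocalDiv Ω c (μ δ) v x
              - ∑ k, g k x (Fin.cast hm k)) p (leb Ω))
          (𝓝[>] 0) (𝓝 0)) := by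
  have hp : 1 ≤ p := Fact.out
  have hΩm := hΩ.measurableSet
  have hU : ∀ δ > 0, MeasurableSet (nonlocalDomain Ω δ) := fun δ hδ =>
    (isOpen_nonlocalDomain hΩ hδ.le).measurableSet
  have hT := fun δ (hδ : 0 < δ) k =>
    exists_continuousLinearMap_extNonlocalDeriv (p := p) hΩm (hU δ hδ) (hμ δ hδ k) (hsupp δ hδ k)
  have hinner : ∀ (y : Space d) (k : Fin d), (inner ℝ y (stdBasis k) : ℝ) = y k := fun y k => by
    simp [stdBasis, EuclideanSpace.inner_single_right]
  have hlim : p ≠ ∞ → ∀ (k : Fin m) (hk : (k : ℕ) < d), ∀ δ₀ > 0, ∀ (u : Space d → ℝ)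
      (g : Space d → Space d), MemW1p (nonlocalDomain Ω δ₀) p u g →
      Tendsto (fun δ : ℝ => eLpNorm
        (fun x => extNonlocalDeriv Ω (μ δ k) u x - g x ⟨k, hk⟩) p (leb Ω)) (𝓝[>] 0) (𝓝 0) ∧
      ∀ᶠ δ in 𝓝[>] (0 : ℝ), AEStronglyMeasurable
        (fun x => extNonlocalDeriv Ω (μ δ k) u x - g x ⟨k, hk⟩) (leb Ω) := by
    intro hpt k hk δ₀ hδ₀ u g hug
    simp_rw [← hinner]
    exact ⟨tendsto_eLpNorm_extNonlocalDeriv_sub hpt hΩ hΩb (fun δ hδ => hμ δ hδ k)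
      (fun δ hδ => hsupp δ hδ k) (hmom k hk) hδ₀ hug,
      eventually_aestronglyMeasurable_extNonlocalDeriv_sub hΩ (fun δ hδ => hμ δ hδ k)
      (fun δ hδ => hsupp δ hδ k) _ hδ₀ hug⟩
  refine ⟨fun δ hδ u hu k =>
    ae_integrable_integrand hp hΩm (hU δ hδ) (hμ δ hδ k) (hsupp δ hδ k) hu,
    fun δ hδ => ?_, fun δ hδ => ?_, fun δ hδ => ?_, fun hpt hm δ₀ hδ₀ u g hug => ?_,
    fun hpt hm hc δ₀ hδ₀ u g hug => ?_, fun hpt hm hc δ₀ hδ₀ v g hvg => ?_⟩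
  · choose T hT using hT δ hδ
    refine ⟨∑ k, c k • T k, fun u hu => ?_⟩
    have h1 : (∑ k, c k • T k) (hu.toLp u) = ∑ k, c k • T k (hu.toLp u) := by
      simp
    rw [h1]
    exact coeFn_sum_smul_ae_eq fun k => hT k u hu
  · choose T hT using hT δ hδ
    refine ⟨ContinuousLinearMap.pi fun k => c k • T k, fun u hu k => ?_⟩
    rw [ContinuousLinearMap.pi_apply, smul_apply]
    filter_upwards [Lp.coeFn_smul (c k) (T k (hu.toLp u)), hT k u hu] with x h1 h2
    rw [h1, Pi.smul_apply, h2, smul_eq_mul, nonlocalGrad]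
  · choose T hT using hT δ hδ
    refine ⟨∑ k, c k • (T k).comp (ContinuousLinearMap.proj k), fun v hv => ?_⟩
    have h1 : (∑ k, c k • (T k).comp (ContinuousLinearMap.proj k))
        (fun k => (hv k).toLp (v k)) = ∑ k, c k • T k ((hv k).toLp (v k)) := by
      simp
    rw [h1]
    exact coeFn_sum_smul_ae_eq fun k => hT k (v k) (hv k)
  · have h := fun k : Fin m => hlim hpt k (k.2.trans_le hm) δ₀ hδ₀ u g hug
    have hs := tendsto_eLpNorm_sum_zero (μ := leb Ω) hp (s := Finset.univ)
      (fun k _ => (h k).2.mono fun δ hδ => hδ.const_smul (c k))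
      (fun k _ => tendsto_eLpNorm_const_smul_zero (c k) (h k).1)
    refine hs.congr fun δ => ?_
    congr 1; ext x
    simp only [nonlocalOp, Pi.smul_apply, smul_eq_mul, mul_sub, Finset.sum_sub_distrib]
    rfl
  · subst hm
    -- The error of the gradient is the sum of the errors of its components times the `e_k`.
    have h := fun k : Fin m => hlim hpt k k.2 δ₀ hδ₀ u g hug
    have hs := tendsto_eLpNorm_sum_zero (μ := leb Ω) hp (s := Finset.univ)
      (fun k _ => (h k).2.mono fun δ hδ => hδ.smul_const (stdBasis k : Space m))
      (fun k _ => tendsto_eLpNorm_smul_stdBasis_zero k (h k).1)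
    refine hs.congr fun δ => ?_
    congr 1; ext x i
    simp [nonlocalGrad, hc, stdBasis, Pi.single_apply]
  · subst hm
    have h := fun k : Fin m => hlim hpt k k.2 δ₀ hδ₀ (v k) (g k) (hvg k)
    have hs := tendsto_eLpNorm_sum_zero (μ := leb Ω) hp (s := Finset.univ)
      (fun k _ => (h k).2) (fun k _ => (h k).1)
    refine hs.congr fun δ => ?_
    congr 1; ext x
    simp only [nonlocalDiv, hc, one_mul, Finset.sum_sub_distrib]
    rfl
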